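/- Conventions. Let $\sigma$ be a relational vocabulary (a set of relation symbols, each of positive arity), possibly infinite, and let $k$ be a positive integer. For a $\sigma$-structure $\mathscr{A}$ with universe $A$, let $\mathbb{E}_k\mathscr{A}$ be the $\sigma$-structure whose universe $\mathbb{E}_kA$ is the set of non-empty sequences of length $\le k$ on $A$, where, with $\varepsilon[a_1,\dots,a_j]=a_j$ and $\sqsubseteq$ the prefix order, $R^{\mathbb{E}_k\mathscr{A}}(s_1,\dots,s_n)$ holds iff the $s_i$ are pairwise comparable under $\sqsubseteq$ and $R^{\mathscr{A}}(\varepsilon s_1,\dots,\varepsilon s_n)$. For a function $f:\mathbb{E}_kA\to B$ define $f^*:\mathbb{E}_kA\to\mathbb{E}_kB$ by $f^*[a_1,\dots,a_j]=[b_1,\dots,b_j]$ with $b_i=f[a_1,\dots,a_i]$. With counit $\varepsilon$ and coextension $(\cdot)^*$, $\mathbb{E}_k$ is a comonad (in Kleisli form) on $\sigma$-structures and homomorphisms; a coKleisli morphism from $\mathscr{A}$ to $\mathscr{B}$ is a homomorphism $\mathbb{E}_k\mathscr{A}\to\mathscr{B}$. Logics. Formulas are those of infinitary first-order logic $\mathcal{L}_{\infty,\omega}$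 with equality, that is, with conjunctions and disjunctions over arbitrary index sets. $\mathcal{L}_k$ is the set of sentences of quantifier rank $\le k$; $\exists\mathcal{L}_k$ is the set of those sentences of $\mathcal{L}_k$ that are built from atomic formulas using only $\wedge$, $\vee$ (possibly infinitary) and $\exists$; $\mathcal{L}_k(\#)$ is the extension of $\mathcal{L}_k$ that also allows the counting quantifiers $\exists_{\ge n}$, $\exists_{\le n}$ ($n\in\mathbb{N}$), each of which adds $1$ to the quantifier rank. For such a logic $\mathcal{L}$, $\mathscr{A}\equiv^{\mathcal{L}}\mathscr{B}$ means that $\mathscr{A}$ and $\mathscr{B}$ satisfy the same sentences of $\mathcal{L}$. Relations between structures. - $\mathscr{A}\rightleftarrows_k\mathscr{B}$ iff there are homomorphisms $\mathbb{E}_k\mathscr{A}\to\mathscr{B}$ and $\mathbb{E}_k\mathscr{B}\to\mathscr{A}$. - Let $\mathsf{W}_{\mathscr{A},\mathscr{B}}$ be the set of pairs $([a_1,\dots,a_j],[b_1,\dots,b_j])\in\mathbb{E}_kA\times\mathbb{E}_kB$ such that $\{(a_i,b_i)\mid 1\le i\le j\}$ is a partial isomorphism (it is the graph of a bijection between subsets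 of $A$ and $B$ that preserves and reflects all relations), and let $\mathcal{S}(\mathscr{A},\mathscr{B})$ be the set of functions $f:\mathbb{E}_kA\to B$ with $(s,f^*(s))\in\mathsf{W}_{\mathscr{A},\mathscr{B}}$ for all $s$. Then $\mathscr{A}\leftrightarrow_k\mathscr{B}$ iff there are non-empty sets $F\subseteq\mathcal{S}(\mathscr{A},\mathscr{B})$ and $G\subseteq\mathcal{S}(\mathscr{B},\mathscr{A})$ forming a locally invertible pair: for all $f\in F$ and $s\in\mathbb{E}_kA$ there is $g\in G$ with $g^*f^*(s)=s$, and for all $g\in G$ and $t\in\mathbb{E}_kB$ there is $f\in F$ with $f^*g^*(t)=t$. - A coKleisli morphism $f:\mathbb{E}_k\mathscr{A}\to\mathscr{B}$ is an $I$-morphism if $s\sqsubseteq t$ and $\varepsilon(s)=\varepsilon(t)$ imply $f(s)=f(t)$. Then $\mathscr{A}\cong_k\mathscr{B}$ iff there are $I$-morphisms $f:\mathbb{E}_k\mathscr{A}\to\mathscr{B}$ and $g:\mathbb{E}_k\mathscr{B}\to\mathscr{A}$ such that $f^*$ and $g^*$ are mutually inverse. Theorem. 1. For all $\sigma$-structures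 $\mathscr{A},\mathscr{B}$: $\mathscr{A}\equiv^{\exists\mathcal{L}_k}\mathscr{B}\iff\mathscr{A}\rightleftarrows_k\mathscr{B}$. 2. For all $\sigma$-structures $\mathscr{A},\mathscr{B}$: $\mathscr{A}\equiv^{\mathcal{L}_k}\mathscr{B}\iff\mathscr{A}\leftrightarrow_k\mathscr{B}$. 3. For all $\sigma$-structures $\mathscr{A},\mathscr{B}$ with finite universes: $\mathscr{A}\equiv^{\mathcal{L}_k(\#)}\mathscr{B}\iff\mathscr{A}\cong_k\mathscr{B}$. -/

import Mathlib

open scoped FirstOrder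

universe u₀ u v w

namespace EFComonad

/-! ### Infinitary formulas with counting quantifiers -/

/-- Formulas of infinitary logic `L_{∞,ω}` with equality, extended with the counting quantifiers
`∃_{≥ N}` and `∃_{≤ N}`, over the relation symbols of `L`, with free variables `x_0, …, x_{n-1}`.
Conjunctions and disjunctions range over arbitrary index types (in `Type w`). A quantifier binds
the variable `x_n` of a formula whose free variables are among `x_0, …, x_n`. It is meant for
relational vocabularies, where the only terms are variables. -/
inductive Formula (L : FirstOrder.Language.{u₀, u}) : ℕ → Type (max u (w + 1))
  | rel {n m : ℕ} (R : L.Relations m) (x : Fin m → Fin n) : Formula L n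
  | eq {n : ℕ} (i j : Fin n) : Formula L n
  | not {n : ℕ} (φ : Formula L n) : Formula L n
  | conj {n : ℕ} {ι : Type w} (φ : ι → Formula L n) : Formula L n
  | disj {n : ℕ} {ι : Type w} (φ : ι → Formula L n) : Formula L n
  | ex {n : ℕ} (φ : Formula L (n + 1)) : Formula L n
  | all {n : ℕ} (φ : Formula L (n + 1)) : Formula L n
  | exGE {n : ℕ} (N : ℕ) (φ : Formula L (n + 1)) : Formula L n
  | exLE {n : ℕ} (N : ℕ) (φ : Formula L (n + 1)) : Formula L n

namespace Formula

variable {L : FirstOrder.Language.{u₀, u}}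

/-- Satisfaction of a formula in a structure under an assignment of its free variables. -/
def Realize {A : Type v} [L.Structure A] : {n : ℕ} → Formula.{u₀, u, w} L n → (Fin n → A) → Prop
  | _, rel R x, e => FirstOrder.Language.Structure.RelMap R (fun i => e (x i))
  | _, eq i j, e => e i = e j
  | _, not φ, e => ¬ φ.Realize e
  | _, conj φ, e => ∀ i, (φ i).Realize e
  | _, disj φ, e => ∃ i, (φ i).Realize e
  | _, ex φ, e => ∃ a : A, φ.Realize (Fin.snoc e a)
  | _, all φ, e => ∀ a : A, φ.Realize (Fin.snoc e a)
  | _, exGE N φ, e => (N : ℕ∞) ≤ {a : A | φ.Realize (Fin.snoc e a)}.encard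
  | _, exLE N φ, e => {a : A | φ.Realize (Fin.snoc e a)}.encard ≤ (N : ℕ∞)

/-- The quantifier rank: the maximal nesting depth of quantifiers (`⊤` if it is not bounded by a
natural number). Each counting quantifier counts as one quantifier. -/
noncomputable def quantifierRank : {n : ℕ} → Formula.{u₀, u, w} L n → ℕ∞
  | _, rel _ _ => 0
  | _, eq _ _ => 0
  | _, not φ => φ.quantifierRank
  | _, conj φ => ⨆ i, (φ i).quantifierRank
  | _, disj φ => ⨆ i, (φ i).quantifierRank
  | _, ex φ => φ.quantifierRank + 1
  | _, all φ => φ.quantifierRank + 1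
  | _, exGE _ φ => φ.quantifierRank + 1
  | _, exLE _ φ => φ.quantifierRank + 1

/-- The formula contains no counting quantifier. -/
def CountingFree : {n : ℕ} → Formula.{u₀, u, w} L n → Prop
  | _, rel _ _ => True
  | _, eq _ _ => True
  | _, not φ => φ.CountingFree
  | _, conj φ => ∀ i, (φ i).CountingFree
  | _, disj φ => ∀ i, (φ i).CountingFree
  | _, ex φ => φ.CountingFree
  | _, all φ => φ.CountingFree
  | _, exGE _ _ => False
  | _, exLE _ _ => False

/-- The formula is built from atomic formulas by conjunction, disjunction and `∃` only. -/
def ExistentialPositive : {n : ℕ} → Formula.{u₀, u, w} L n → Prop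
  | _, rel _ _ => True
  | _, eq _ _ => True
  | _, not _ => False
  | _, conj φ => ∀ i, (φ i).ExistentialPositive
  | _, disj φ => ∀ i, (φ i).ExistentialPositive
  | _, ex φ => φ.ExistentialPositive
  | _, all _ => False
  | _, exGE _ _ => False
  | _, exLE _ _ => False

end Formula

/-- A sentence `φ` holds in the structure `A`. -/
def Models {L : FirstOrder.Language.{u₀, u}} (A : Type v) [L.Structure A] (φ : Formula.{u₀, u, w} L 0) :
    Prop :=
  φ.Realize (A := A) Fin.elim0

/-- The sentences of `L_k(#)`: infinitary sentences, possibly with counting quantifiers, of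
quantifier rank at most `k`. (The variables of such a sentence are among `x_0, …, x_{k-1}`.) -/
def countingSentences (L : FirstOrder.Language.{u₀, u}) (k : ℕ) : Set (Formula.{u₀, u, w} L 0) :=
  {φ | φ.quantifierRank ≤ k}

/-- The sentences of `L_k`: infinitary sentences of quantifier rank at most `k`. -/
def sentences (L : FirstOrder.Language.{u₀, u}) (k : ℕ) : Set (Formula.{u₀, u, w} L 0) :=
  {φ | φ.CountingFree ∧ φ.quantifierRank ≤ k}

/-- The sentences of `∃L_k`: existential positive sentences of quantifier rank at most `k`. -/
def existentialPositiveSentences (L : FirstOrder.Language.{u₀, u}) (k : ℕ) :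
    Set (Formula.{u₀, u, w} L 0) :=
  {φ | φ.ExistentialPositive ∧ φ.quantifierRank ≤ k}

/-- `A` and `B` satisfy the same sentences of `S`. -/
def EquivOn {L : FirstOrder.Language.{u₀, u}} (S : Set (Formula.{u₀, u, w} L 0))
    (A B : Type v) [L.Structure A] [L.Structure B] : Prop :=
  ∀ φ ∈ S, Models A φ ↔ Models B φ

/-! ### The Ehrenfeucht–Fraïssé comonad -/

/-- The universe of `E_k A`: non-empty sequences of length at most `k` on `A`. -/
def E (k : ℕ) (A : Type v) : Type v := {s : List A // s ≠ [] ∧ s.length ≤ k}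

namespace E

variable {k : ℕ} {A B C : Type v}

/-- The prefix ordering. -/
def Prefix (s t : E k A) : Prop := s.1 <+: t.1

/-- The counit: the last element of a sequence. -/
def counit (s : E k A) : A := s.1.getLast s.2.1

/-- The non-empty prefix `[a_1, …, a_{i+1}]` of `s = [a_1, …, a_j]`, for `i < j`. -/
def initial (s : E k A) (i : Fin s.1.length) : E k A :=
  ⟨s.1.take (i + 1),
    List.ne_nil_of_length_pos (by rw [List.length_take]; omega),
    by have := s.2.2; rw [List.length_take]; omega⟩

/-- The coextension `f^* [a_1, …, a_j] = [b_1, …, b_j]`, where `b_i = f [a_1, …, a_i]`. -/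
def coext (f : E k A → B) (s : E k A) : E k B :=
  ⟨List.ofFn fun i => f (s.initial i),
    List.ne_nil_of_length_pos (by
      rw [List.length_ofFn]; exact List.length_pos_of_ne_nil s.2.1),
    by rw [List.length_ofFn]; exact s.2.2⟩

variable {L : FirstOrder.Language.{u₀, u}} [L.IsRelational]

/-- The structure `E_k A`: a tuple of sequences is related iff the sequences are pairwise
comparable for the prefix ordering and their last elements are related in `A`. -/
instance instStructure [L.Structure A] : L.Structure (E k A) where
  funMap F := isEmptyElim F
  RelMap R s := (∀ i j, (s i).Prefix (s j) ∨ (s j).Prefix (s i)) ∧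
    FirstOrder.Language.Structure.RelMap R (fun i => (s i).counit)

/-! The data above form a comonad in Kleisli form on relational structures. -/

theorem counit_coext (f : E k A → B) (s : E k A) : (coext f s).counit = f s := by
  have hpos := List.length_pos_of_ne_nil s.2.1
  simp only [counit, coext, List.getLast_eq_getElem, List.getElem_ofFn, List.length_ofFn]
  congr 1
  apply Subtype.ext
  simp only [initial]
  rw [Nat.sub_add_cancel hpos, List.take_length]

theorem coext_counit (s : E k A) : coext counit s = s := by
  apply Subtype.ext
  apply List.ext_getElem
  · simp [coext]
  · intro i h1 h2
    simp only [counit, coext, List.getLast_eq_getElem, List.getElem_ofFn, initial,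
      List.getElem_take]
    congr 1
    simp only [List.length_take]
    omega

theorem initial_coext (f : E k A → B) (s : E k A) (i : Fin s.1.length) :
    (coext f s).initial (Fin.cast (by simp [coext]) i) = coext f (s.initial i) := by
  apply Subtype.ext
  apply List.ext_getElem
  · simp only [coext, initial, List.length_ofFn, List.length_take]
    rfl
  · intro j h1 h2
    have hj : j < (i : ℕ) + 1 := by
      simp only [coext, initial, List.length_ofFn, List.length_take] at h2
      omega
    simp only [coext, initial, List.getElem_take, List.getElem_ofFn, List.take_take]
    congr 1
    apply Subtype.ext
    simp only
    congr 1
    omega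

theorem coext_comp (g : E k B → C) (f : E k A → B) (s : E k A) :
    coext (fun s => g (coext f s)) s = coext g (coext f s) := by
  apply Subtype.ext
  apply List.ext_getElem
  · simp [coext]
  · intro i h1 h2
    have hi : i < s.1.length := by simpa [coext] using h1
    have h := initial_coext f s ⟨i, hi⟩
    simp only [coext, List.getElem_ofFn] at h ⊢
    rw [← h]
    rfl

theorem Prefix.coext {s t : E k A} (h : s.Prefix t) (f : E k A → B) :
    (coext f s).Prefix (E.coext f t) := by
  obtain ⟨r, hr⟩ := h
  have hlen : s.1.length ≤ t.1.length := by rw [← hr]; simp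
  have hs : ∀ m ≤ s.1.length, s.1.take m = t.1.take m := by
    intro m hm
    rw [← hr, List.take_append_of_le_length hm]
  have key : (E.coext f s).1 = (E.coext f t).1.take s.1.length := by
    apply List.ext_getElem
    · simp [E.coext, hlen]
    · intro i h1 h2
      have hi : i < s.1.length := by simpa [E.coext] using h1
      simp only [E.coext, List.getElem_ofFn, List.getElem_take]
      congr 1
      exact Subtype.ext (hs _ hi)
  rw [Prefix, key]
  exact List.take_prefix _ _

/-- The counit as a homomorphism `E_k A → A`. -/
def counitHom [L.Structure A] : E k A →[L] A where
  toFun := counit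
  map_fun' F := isEmptyElim F
  map_rel' _ _ h := h.2

/-- The coextension of a homomorphism `E_k A → B` as a homomorphism `E_k A → E_k B`. -/
def coextHom [L.Structure A] [L.Structure B] (f : E k A →[L] B) : E k A →[L] E k B where
  toFun := coext f
  map_fun' F := isEmptyElim F
  map_rel' R s h := by
    refine ⟨fun i j => (h.1 i j).imp (fun h => h.coext f) (fun h => h.coext f), ?_⟩
    simp only [Function.comp_apply, counit_coext]
    exact f.map_rel R s h

end E

section Equivalences

variable (L : FirstOrder.Language.{u₀, u}) [L.IsRelational] (k : ℕ) (A B : Type v)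
  [L.Structure A] [L.Structure B]

/-- A coKleisli morphism from `A` to `B` is a homomorphism `E_k A → B`. -/
abbrev CoKleisliHom : Type v := E k A →[L] B

/-- There are coKleisli morphisms in both directions. -/
def CoKleisliBothWays : Prop :=
  Nonempty (CoKleisliHom L k A B) ∧ Nonempty (CoKleisliHom L k B A)

variable {A B} in
/-- The relation `r ⊆ A × B` is (the graph of) a partial isomorphism: a bijection between a subset
of `A` and a subset of `B` that preserves and reflects all relations. -/
def IsPartialIso (r : Set (A × B)) : Prop :=
  (∀ p ∈ r, ∀ q ∈ r, p.1 = q.1 ↔ p.2 = q.2) ∧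
  ∀ (n : ℕ) (R : L.Relations n) (p : Fin n → A × B), (∀ i, p i ∈ r) →
    (FirstOrder.Language.Structure.RelMap R (fun i => (p i).1) ↔
      FirstOrder.Language.Structure.RelMap R (fun i => (p i).2))

/-- The winning positions: pairs `([a_1, …, a_j], [b_1, …, b_j])` such that
`{(a_i, b_i) | 1 ≤ i ≤ j}` is a partial isomorphism. -/
def W : Set (E k A × E k B) :=
  {p | p.1.1.length = p.2.1.length ∧ IsPartialIso L {q | q ∈ p.1.1.zip p.2.1}}

/-- The functions `f : E_k A → B` such that every `(s, f^* s)` is a winning position. -/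
def S : Set (E k A → B) := {f | ∀ s, (s, E.coext f s) ∈ W L k A B}

variable {A B} in
/-- The pair `(F, G)` is a locally invertible pair from `A` to `B`. -/
structure IsLocallyInvertiblePair (F : Set (E k A → B)) (G : Set (E k B → A)) : Prop where
  left_subset : F ⊆ S L k A B
  right_subset : G ⊆ S L k B A
  left_inv : ∀ f ∈ F, ∀ s, ∃ g ∈ G, E.coext g (E.coext f s) = s
  right_inv : ∀ g ∈ G, ∀ t, ∃ f ∈ F, E.coext f (E.coext g t) = t

/-- Back-and-forth equivalence: there is a locally invertible pair of non-empty sets. -/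
def BackAndForth : Prop :=
  ∃ (F : Set (E k A → B)) (G : Set (E k B → A)),
    F.Nonempty ∧ G.Nonempty ∧ IsLocallyInvertiblePair L k F G

variable {L k A B} in
/-- A coKleisli morphism `f` is an `I`-morphism if `f s = f t` whenever `s` is a prefix of `t`
with the same last element. -/
def IsIMorphism (f : CoKleisliHom L k A B) : Prop :=
  ∀ s t : E k A, s.Prefix t → s.counit = t.counit → f s = f t

/-- `A` and `B` are isomorphic in the coKleisli category via `I`-morphisms: there are `I`-morphisms
`f`, `g` whose coextensions are mutually inverse. -/
def CoKleisliIso : Prop :=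
  ∃ (f : CoKleisliHom L k A B) (g : CoKleisliHom L k B A), IsIMorphism f ∧ IsIMorphism g ∧
    Function.LeftInverse (E.coextHom g) (E.coextHom f) ∧
    Function.RightInverse (E.coextHom g) (E.coextHom f)

end Equivalences

end EFComonad

/-!
The comonad `E k` encodes the `k`-round Ehrenfeucht–Fraïssé game: a function `f : E k A → B` is a
deterministic strategy of the player answering in `B`, and `coext f s` is the list of its answers
to the moves `s`. Each of the three relations says that such strategies exist, of a kind matching
one logic.

From logic to strategies, call a position `(s, t)` good if the formulas of the logic of rank at most
the number of remaining rounds that hold at `s` hold at `t`. The key fact is that each move in a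
good position has an answer leading to a good position. Otherwise every candidate answer `b`
is refuted by a formula true after the move, and the existential quantification of the conjunction
of these formulas, which is infinitary if `B` is infinite, contradicts goodness
(`Preserves.forth`). With counting quantifiers and finite structures, each type of a further element
is defined by one formula, so the types are realized equally often in `A` and `B`, and the answers
can be given by a bijection (`Preserves.exists_equiv`). Following good answers gives strategies
(`exists_strategy`), which are homomorphisms on `E k A` because pairwise comparable sequences are
prefixes of a single play (`homOfSimilar`). A strategy can also be made to follow a prescribed good
play (`exists_strategy_through`), which gives local invertibility; and mutually inverse bijections
give mutually inverse coextensions (`run_run`).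

From strategies to logic, one inducts on formulas along the plays (`realize_iff_of_backAndForth`).
For existential positive formulas the strategy need not respect equality, so it is only asked about
elements that have not been played before (`realize_of_coKleisliHom`).
-/

open FirstOrder.Language (Structure)

namespace EFComonad

/-! ### Coextensions and plays -/

namespace E

variable {k : ℕ} {A B : Type v}

/-- The coextension extended to possibly empty sequences: `lift f [a_1, …, a_j] = [b_1, …, b_j]`
with `b_i = f [a_1, …, a_i]`. It agrees with `coext f` definitionally on `E k A`. -/
def lift (f : E k A → B) (s : List A) (hs : s.length ≤ k) : List B :=
  List.ofFn fun i : Fin s.length => f ⟨s.take (i + 1),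
    List.ne_nil_of_length_pos (by rw [List.length_take]; omega),
    by rw [List.length_take]; omega⟩

@[simp]
theorem length_lift (f : E k A → B) (s : List A) (hs : s.length ≤ k) :
    (lift f s hs).length = s.length := by
  simp [lift]

theorem lift_append (f : E k A → B) (s : List A) (a : A) (h : (s ++ [a]).length ≤ k) :
    lift f (s ++ [a]) h = lift f s (by simp at h; omega) ++ [f ⟨s ++ [a], by simp, h⟩] := by
  apply List.ext_getElem
  · simp
  · intro i h1 h2
    have hi : i < s.length + 1 := by simpa using h1
    rcases Nat.lt_succ_iff_lt_or_eq.1 hi with hi | rfl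
    · rw [List.getElem_append_left (by simpa using hi)]
      simp only [lift, List.getElem_ofFn]
      congr 1
      apply Subtype.ext
      exact List.take_append_of_le_length hi
    · rw [List.getElem_append_right (by simp)]
      simp only [lift, List.getElem_ofFn, List.getElem_singleton]
      congr 1
      apply Subtype.ext
      exact List.take_of_length_le (by simp)

/-- A prefix of `t` is one of its initial segments. -/
theorem Prefix.exists_initial {s t : E k A} (h : s.Prefix t) :
    ∃ i : Fin t.1.length, t.initial i = s ∧ t.1.get i = s.counit := by
  have hpos := List.length_pos_of_ne_nil s.2.1
  have hle := h.length_le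
  have hs : t.initial ⟨s.1.length - 1, by omega⟩ = s := by
    apply Subtype.ext
    simp only [initial, Nat.sub_add_cancel hpos]
    exact (List.prefix_iff_eq_take.1 h).symm
  refine ⟨⟨s.1.length - 1, by omega⟩, hs, ?_⟩
  simp only [counit, List.getLast_eq_getElem, List.get_eq_getElem]
  exact (h.getElem (by omega)).symm

end E

/-- The responses to the moves `s` of a player following the move function `σ`, where `σ s t a` is
the response to the move `a` in the position `(s, t)`. -/
def run {A B : Type v} (σ : List A → List B → A → B) (s : List A) : List B :=
  (s.foldl (fun p a => (p.1 ++ [a], p.2 ++ [σ p.1 p.2 a])) ([], [])).2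

section Run

variable {k : ℕ} {A B : Type v}

theorem run_append (σ : List A → List B → A → B) (s : List A) (a : A) :
    run σ (s ++ [a]) = run σ s ++ [σ s (run σ s) a] := by
  have h : ∀ s : List A, (s.foldl (fun (p : List A × List B) a =>
      (p.1 ++ [a], p.2 ++ [σ p.1 p.2 a])) ([], [])).1 = s := by
    intro s
    induction s using List.reverseRecOn with
    | nil => rfl
    | append_singleton s a ih => simp [List.foldl_append, ih]
  simp [run, List.foldl_append, h]

@[simp]
theorem length_run (σ : List A → List B → A → B) (s : List A) :
    (run σ s).length = s.length := by
  induction s using List.reverseRecOn with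
  | nil => rfl
  | append_singleton s a ih => simp [run_append, ih]

/-- The function on non-empty sequences given by the last response. -/
def strategy (k : ℕ) (σ : List A → List B → A → B) (s : E k A) : B :=
  σ s.1.dropLast (run σ s.1.dropLast) s.counit

theorem lift_strategy (σ : List A → List B → A → B) (s : List A) (hs : s.length ≤ k) :
    E.lift (strategy k σ) s hs = run σ s := by
  induction s using List.reverseRecOn with
  | nil => simp [E.lift, run]
  | append_singleton s a ih =>
    rw [E.lift_append, ih, run_append]
    simp [strategy, E.counit]

theorem coext_strategy (σ : List A → List B → A → B) (s : E k A) :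
    (E.coext (strategy k σ) s).1 = run σ s.1 :=
  lift_strategy σ s.1 s.2.2

/-- If the responses of both players are given by mutually inverse bijections, then so are the
plays. -/
theorem run_run {σ : List A → List B → A → B} {τ : List B → List A → B → A}
    (h : ∀ s t a, τ t s (σ s t a) = a) (s : List A) : run τ (run σ s) = s := by
  induction s using List.reverseRecOn with
  | nil => rfl
  | append_singleton s a ih => rw [run_append, run_append, ih, h]

/-- A set of positions in which every move has a response staying in the set contains all the plays
of some strategy. -/
theorem exists_strategy {P : List A → List B → Prop} (nil : P [] [])
    (forth : ∀ s t, s.length < k → P s t → ∀ a, ∃ b, P (s ++ [a]) (t ++ [b])) :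
    ∃ f : E k A → B, ∀ s, P s.1 (E.coext f s).1 := by
  rcases isEmpty_or_nonempty B with hB | hB
  · have : IsEmpty (E k A) := ⟨fun s => by
      obtain ⟨b, -⟩ := forth [] [] ((List.length_pos_of_ne_nil s.2.1).trans_le s.2.2) nil s.counit
      exact hB.elim b⟩
    exact ⟨isEmptyElim, isEmptyElim⟩
  · have hσ : ∀ s t a, ∃ b, s.length < k → P s t → P (s ++ [a]) (t ++ [b]) := by
      intro s t a
      by_cases h : s.length < k ∧ P s t
      · obtain ⟨b, hb⟩ := forth s t h.1 h.2 a
        exact ⟨b, fun _ _ => hb⟩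
      · exact ⟨Classical.arbitrary B, fun h1 h2 => (h ⟨h1, h2⟩).elim⟩
    choose σ hσ using hσ
    have key : ∀ s : List A, s.length ≤ k → P s (run σ s) := by
      intro s
      induction s using List.reverseRecOn with
      | nil => exact fun _ => nil
      | append_singleton s a ih =>
        intro hs
        rw [List.length_append, List.length_singleton] at hs
        rw [run_append]
        exact hσ _ _ _ (by omega) (ih (by omega))
    refine ⟨strategy k σ, fun s => ?_⟩
    rw [coext_strategy]
    exact key _ s.2.2

/-- A refinement of `exists_strategy`: the strategy can be made to follow a given play
`(s₀, t₀)` in the set. -/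
theorem exists_strategy_through {P : List A → List B → Prop}
    (forth : ∀ s t, s.length < k → P s t → ∀ a, ∃ b, P (s ++ [a]) (t ++ [b]))
    (s₀ : E k A) (t₀ : E k B) (hlen : s₀.1.length = t₀.1.length)
    (h₀ : ∀ n, P (s₀.1.take n) (t₀.1.take n)) :
    ∃ f : E k A → B, (∀ s, P s.1 (E.coext f s).1) ∧ E.coext f s₀ = t₀ := by
  -- The second conjunct forces the responses along `s₀`.
  obtain ⟨f, hf⟩ := exists_strategy (k := k)
    (P := fun s t => P s t ∧ (s <+: s₀.1 → t = t₀.1.take s.length))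
    ⟨by simpa using h₀ 0, by simp⟩ (by
      rintro s t hs ⟨hP, ht⟩ a
      by_cases hsa : s ++ [a] <+: s₀.1
      · have hlt : s.length < t₀.1.length := by
          have := hsa.length_le
          simp at this
          omega
        have ht' := ht ((List.prefix_append _ _).trans hsa)
        have hnext : t ++ [t₀.1[s.length] ] = t₀.1.take (s.length + 1) := by
          rw [ht', List.take_append_getElem]
        refine ⟨t₀.1[s.length], ?_, fun _ => by simpa using hnext⟩
        rw [hnext, List.prefix_iff_eq_take.1 hsa, List.length_append, List.length_singleton]
        exact h₀ _
      · obtain ⟨b, hb⟩ := forth s t hs hP a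
        exact ⟨b, hb, fun h => (hsa h).elim⟩)
  refine ⟨f, fun s => (hf s).1, Subtype.ext ?_⟩
  rw [(hf s₀).2 List.prefix_rfl, hlen, List.take_length]

end Run

/-! ### Preservation of formulas -/

variable {L : FirstOrder.Language.{u₀, u}} {A B : Type v} [L.Structure A] [L.Structure B]

/-- The assignments `e` and `e'` satisfy the same atomic formulas. -/
def AtomicEquiv (L : FirstOrder.Language.{u₀, u}) [L.Structure A] [L.Structure B] {n : ℕ}
    (e : Fin n → A) (e' : Fin n → B) : Prop :=
  (∀ i j, e i = e j ↔ e' i = e' j) ∧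
  ∀ (m : ℕ) (R : L.Relations m) (x : Fin m → Fin n),
    Structure.RelMap R (fun i => e (x i)) ↔ Structure.RelMap R (fun i => e' (x i))

theorem atomicEquiv_zero [IsEmpty (L.Relations 0)] (e : Fin 0 → A) (e' : Fin 0 → B) :
    AtomicEquiv L e e' := by
  refine ⟨fun i => i.elim0, fun m R x => ?_⟩
  cases m with
  | zero => exact isEmptyElim R
  | succ m => exact (x 0).elim0

theorem isPartialIso_zip_ofFn {n : ℕ} (e : Fin n → A) (e' : Fin n → B) :
    IsPartialIso L {q | q ∈ (List.ofFn e).zip (List.ofFn e')} ↔ AtomicEquiv L e e' := by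
  have hmem : ∀ q, q ∈ (List.ofFn e).zip (List.ofFn e') ↔ ∃ i, (e i, e' i) = q := by
    intro q
    have hz : (List.ofFn e).zip (List.ofFn e') = List.ofFn fun i => (e i, e' i) :=
      List.ext_getElem (by simp) (by simp)
    rw [hz, List.mem_ofFn]
  constructor
  · rintro ⟨h1, h2⟩
    exact ⟨fun i j => h1 _ ((hmem _).2 ⟨i, rfl⟩) _ ((hmem _).2 ⟨j, rfl⟩),
      fun m R x => h2 m R (fun i => (e (x i), e' (x i))) fun i => (hmem _).2 ⟨x i, rfl⟩⟩
  · rintro ⟨h1, h2⟩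
    refine ⟨fun p hp q hq => ?_, fun m R p hp => ?_⟩
    · obtain ⟨i, rfl⟩ := (hmem _).1 hp
      obtain ⟨j, rfl⟩ := (hmem _).1 hq
      exact h1 i j
    · choose x hx using fun i => (hmem _).1 (hp i)
      obtain rfl : (fun i => (e (x i), e' (x i))) = p := funext hx
      exact h2 m R x

/-- A class of formulas containing the atomic formulas and closed under conjunctions and `∃`. -/
structure IsFragment (Γ : ∀ n, Formula.{u₀, u, w} L n → Prop) : Prop where
  rel : ∀ {n m : ℕ} (R : L.Relations m) (x : Fin m → Fin n), Γ n (.rel R x)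
  eq : ∀ {n : ℕ} (i j : Fin n), Γ n (.eq i j)
  conj : ∀ {n : ℕ} {ι : Type w} (φ : ι → Formula L n), (∀ i, Γ n (φ i)) → Γ n (.conj φ)
  ex : ∀ {n : ℕ} (φ : Formula L (n + 1)), Γ (n + 1) φ → Γ n (.ex φ)

/-- The formulas of `Γ` of quantifier rank at most `m` true at `e` are true at `e'`. -/
def Preserves (Γ : ∀ n, Formula.{u₀, u, w} L n → Prop) (m : ℕ) {n : ℕ} (e : Fin n → A)
    (e' : Fin n → B) : Prop :=
  ∀ φ, Γ n φ → φ.quantifierRank ≤ m → φ.Realize e → φ.Realize e'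

section Fragments

variable {Γ : ∀ n, Formula.{u₀, u, w} L n → Prop} {m n : ℕ} {e : Fin n → A} {e' : Fin n → B}

theorem Preserves.symm (hnot : ∀ n φ, Γ n φ → Γ n (.not φ)) (h : Preserves Γ m e e') :
    Preserves Γ m e' e := by
  intro φ hφ hr h'
  by_contra hcon
  exact h (.not φ) (hnot _ _ hφ) (by simpa [Formula.quantifierRank] using hr)
    (by simpa [Formula.Realize] using hcon) h'

theorem Preserves.rel (hΓ : IsFragment Γ) (h : Preserves Γ m e e') {l : ℕ} (R : L.Relations l)
    (x : Fin l → Fin n) (hR : Structure.RelMap R (fun i => e (x i))) :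
    Structure.RelMap R (fun i => e' (x i)) :=
  h (.rel R x) (hΓ.rel R x) (by simp [Formula.quantifierRank]) hR

theorem Preserves.eq (hΓ : IsFragment Γ) (h : Preserves Γ m e e') {i j : Fin n}
    (hij : e i = e j) : e' i = e' j :=
  h (.eq i j) (hΓ.eq i j) (by simp [Formula.quantifierRank]) hij

theorem Preserves.atomicEquiv (hΓ : IsFragment Γ) (hnot : ∀ n φ, Γ n φ → Γ n (.not φ))
    (h : Preserves Γ m e e') : AtomicEquiv L e e' :=
  ⟨fun _ _ => ⟨h.eq hΓ, (h.symm hnot).eq hΓ⟩,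
    fun _ R x => ⟨h.rel hΓ R x, (h.symm hnot).rel hΓ R x⟩⟩

/-- Conjunctions over a small index type, in any universe. -/
theorem IsFragment.exists_conj (hΓ : IsFragment Γ) {ι : Type*} [Small.{w} ι]
    (φ : ι → Formula.{u₀, u, w} L n) (hφ : ∀ i, Γ n (φ i) ∧ (φ i).quantifierRank ≤ m) :
    ∃ ψ : Formula.{u₀, u, w} L n, Γ n ψ ∧ ψ.quantifierRank ≤ m ∧
      (∀ e : Fin n → A, ψ.Realize e ↔ ∀ i, (φ i).Realize e) ∧
      ∀ e : Fin n → B, ψ.Realize e ↔ ∀ i, (φ i).Realize e := by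
  refine ⟨.conj fun i : Shrink.{w} ι => φ ((equivShrink ι).symm i), hΓ.conj _ fun i => (hφ _).1,
    ?_, fun e => ?_, fun e => ?_⟩
  · simpa [Formula.quantifierRank] using fun i => (hφ _).2
  · simpa only [Formula.Realize] using
      (equivShrink ι).symm.forall_congr_left (p := fun i => (φ ((equivShrink ι).symm i)).Realize e)
        |>.trans (by simp)
  · simpa only [Formula.Realize] using
      (equivShrink ι).symm.forall_congr_left (p := fun i => (φ ((equivShrink ι).symm i)).Realize e)
        |>.trans (by simp)

/-- If no response to the move `a` were good, then each `b` would be refuted by a formula, and the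
existential quantification of their conjunction would not be preserved. -/
theorem Preserves.forth [Small.{w} B] (hΓ : IsFragment Γ) (h : Preserves Γ (m + 1) e e') (a : A) :
    ∃ b, Preserves Γ m (Fin.snoc e a : Fin (n + 1) → A) (Fin.snoc e' b : Fin (n + 1) → B) := by
  by_contra! hcon
  simp only [Preserves, not_forall] at hcon
  choose φ hφ hr ha hb using hcon
  obtain ⟨ψ, hψ, hψr, hψA, hψB⟩ := hΓ.exists_conj (A := A) (B := B) φ fun b => ⟨hφ b, hr b⟩
  obtain ⟨b, hb'⟩ := h (.ex ψ) (hΓ.ex ψ hψ)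
    (by simpa [Formula.quantifierRank] using add_le_add_left hψr 1)
    ⟨a, (hψA _).2 ha⟩
  exact hb b ((hψB _).1 hb' b)

end Fragments

theorem isFragment_existentialPositive :
    IsFragment (fun _ (φ : Formula.{u₀, u, w} L _) => φ.ExistentialPositive) where
  rel _ _ := trivial
  eq _ _ := trivial
  conj _ h := h
  ex _ h := h

theorem isFragment_countingFree :
    IsFragment (fun _ (φ : Formula.{u₀, u, w} L _) => φ.CountingFree) where
  rel _ _ := trivial
  eq _ _ := trivial
  conj _ h := h
  ex _ h := h

theorem isFragment_true : IsFragment (fun n (_ : Formula.{u₀, u, w} L n) => True) where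
  rel _ _ := trivial
  eq _ _ := trivial
  conj _ _ := trivial
  ex _ _ := trivial

/-- With counting quantifiers and finite structures, the responses to all moves can be given by a
bijection: each rank-`m` type of one further element is defined by a formula of rank `m`, hence is
realized by equally many elements of `A` and `B`. -/
theorem Preserves.exists_equiv [Small.{w} A] [Small.{w} B] [Finite A] [Finite B] {m n : ℕ}
    {e : Fin n → A} {e' : Fin n → B}
    (h : Preserves (fun n (_ : Formula.{u₀, u, w} L n) => True) (m + 1) e e') :
    ∃ σ : A ≃ B, ∀ a, Preserves (fun n (_ : Formula.{u₀, u, w} L n) => True) m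
      (Fin.snoc e a : Fin (n + 1) → A) (Fin.snoc e' (σ a) : Fin (n + 1) → B) := by
  let Sat (x : A ⊕ B) (φ : Formula.{u₀, u, w} L (n + 1)) : Prop :=
    x.elim (fun a => φ.Realize (Fin.snoc e a : Fin (n + 1) → A))
      (fun b => φ.Realize (Fin.snoc e' b : Fin (n + 1) → B))
  let tp (x : A ⊕ B) : Set (Formula.{u₀, u, w} L (n + 1)) :=
    {φ | φ.quantifierRank ≤ m ∧ Sat x φ}
  have hsep : ∀ x y, ∃ φ : Formula.{u₀, u, w} L (n + 1), φ.quantifierRank ≤ m ∧ Sat x φ ∧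
      (Sat y φ → tp y = tp x) := by
    intro x y
    by_cases hxy : tp y = tp x
    · exact ⟨.conj (ι := PEmpty) PEmpty.elim, by simp [Formula.quantifierRank],
        by cases x <;> simp [Sat, Formula.Realize], fun _ => hxy⟩
    · obtain ⟨φ, hφ⟩ := not_forall.1 (mt Set.ext hxy)
      by_cases hr : φ.quantifierRank ≤ m
      · by_cases hx : Sat x φ
        · exact ⟨φ, hr, hx, fun hy => (hφ (by simp [tp, hr, hx, hy])).elim⟩
        · refine ⟨.not φ, by simpa [Formula.quantifierRank] using hr, ?_, fun hy => ?_⟩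
          · cases x <;> simpa [Sat, Formula.Realize] using hx
          · have hy' : ¬ Sat y φ := by cases y <;> simpa [Sat, Formula.Realize] using hy
            exact (hφ (by simp [tp, hx, hy'])).elim
      · exact (hφ (by simp [tp, hr])).elim
  choose χ hχr hχx hχ using hsep
  -- A single formula `ψ` of rank at most `m` defines the type of `x`.
  have hdef : ∀ x, ∃ ψ : Formula.{u₀, u, w} L (n + 1), ψ.quantifierRank ≤ m ∧
      ∀ y, Sat y ψ ↔ tp y = tp x := by
    intro x
    obtain ⟨ψ, -, hψr, hψA, hψB⟩ := isFragment_true.exists_conj (A := A) (B := B) (χ x)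
      fun y => ⟨trivial, hχr x y⟩
    have hψ : ∀ y, Sat y ψ ↔ ∀ z, Sat y (χ x z) := by
      rintro (a | b)
      · exact hψA _
      · exact hψB _
    refine ⟨ψ, hψr, fun y => ⟨fun hy => hχ x y ((hψ y).1 hy y), fun hy => ?_⟩⟩
    have : ψ ∈ tp y := hy ▸ ⟨hψr, (hψ x).2 (hχx x)⟩
    exact this.2
  have hcard : ∀ x, {a | tp (.inl a) = tp x}.encard = {b | tp (.inr b) = tp x}.encard := by
    intro x
    obtain ⟨ψ, hψr, hψ⟩ := hdef x
    have hA : {a | ψ.Realize (Fin.snoc e a : Fin (n + 1) → A)} = {a | tp (.inl a) = tp x} :=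
      Set.ext fun a => hψ (.inl a)
    have hB : {b | ψ.Realize (Fin.snoc e' b : Fin (n + 1) → B)} = {b | tp (.inr b) = tp x} :=
      Set.ext fun b => hψ (.inr b)
    rw [← hA, ← hB]
    obtain ⟨N, hN⟩ : ∃ N : ℕ, (N : ℕ∞) = {a | ψ.Realize (Fin.snoc e a : Fin (n + 1) → A)}.encard :=
      ⟨_, (Set.toFinite _).cast_ncard_eq⟩
    have hr : ψ.quantifierRank + 1 ≤ ((m + 1 : ℕ) : ℕ∞) := by
      simpa using add_le_add_left hψr 1
    have h1 := h (.exGE N ψ) trivial (by simpa only [Formula.quantifierRank] using hr) hN.le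
    have h2 := h (.exLE N ψ) trivial (by simpa only [Formula.quantifierRank] using hr) hN.ge
    exact hN.symm.trans (le_antisymm h1 h2)
  have hfib : ∀ c, Nonempty ({a // tp (.inl a) = c} ≃ {b // tp (.inr b) = c}) := by
    intro c
    by_cases hc : ∃ x, tp x = c
    · obtain ⟨x, rfl⟩ := hc
      refine Finite.card_eq.1 ?_
      have := congrArg ENat.toNat (hcard x)
      exact this
    · have : IsEmpty {a // tp (.inl a) = c} := ⟨fun a => hc ⟨_, a.2⟩⟩
      have : IsEmpty {b // tp (.inr b) = c} := ⟨fun b => hc ⟨_, b.2⟩⟩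
      exact ⟨Equiv.equivOfIsEmpty _ _⟩
  refine ⟨Equiv.ofFiberEquiv (f := fun a => tp (.inl a)) (g := fun b => tp (.inr b))
    fun c => (hfib c).some, fun a φ _ hr ha => ?_⟩
  have htp := Equiv.ofFiberEquiv_map (f := fun a => tp (.inl a)) (g := fun b => tp (.inr b))
    (fun c => (hfib c).some) a
  have : φ ∈ tp (.inl a) := ⟨hr, ha⟩
  rw [← htp] at this
  exact this.2

/-! ### Positions with equivalent continuations -/

/-- `s = [a_1, …, a_n]` and `t = [b_1, …, b_n]` with `n ≤ k`, and the formulas of `Γ` of rank at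
most `k - n` true at `(a_1, …, a_n)` are true at `(b_1, …, b_n)`. -/
def Similar (Γ : ∀ n, Formula.{u₀, u, w} L n → Prop) (k : ℕ) (s : List A) (t : List B) : Prop :=
  ∃ (n : ℕ) (e : Fin n → A) (e' : Fin n → B),
    n ≤ k ∧ List.ofFn e = s ∧ List.ofFn e' = t ∧ Preserves Γ (k - n) e e'

theorem ofFn_snoc {A : Type v} {n : ℕ} (e : Fin n → A) (a : A) :
    List.ofFn (Fin.snoc e a : Fin (n + 1) → A) = List.ofFn e ++ [a] := by
  rw [List.ofFn_succ_last]
  simp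

section Similar

variable {Γ : ∀ n, Formula.{u₀, u, w} L n → Prop} {k : ℕ}

theorem similar_nil {S : Set (Formula.{u₀, u, w} L 0)}
    (hS : ∀ φ, Γ 0 φ → φ.quantifierRank ≤ k → φ ∈ S) (h : EquivOn S A B) :
    Similar Γ k ([] : List A) ([] : List B) :=
  ⟨0, Fin.elim0, Fin.elim0, Nat.zero_le _, by simp, by simp,
    fun φ hφ hr => (h φ (hS φ hφ (by simpa using hr))).1⟩

theorem Similar.symm (hnot : ∀ n φ, Γ n φ → Γ n (.not φ)) {s : List A} {t : List B}
    (h : Similar Γ k s t) : Similar Γ k t s := by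
  obtain ⟨n, e, e', hn, hs, ht, hp⟩ := h
  exact ⟨n, e', e, hn, ht, hs, hp.symm hnot⟩

theorem Similar.forth [Small.{w} B] (hΓ : IsFragment Γ) {s : List A} {t : List B}
    (hs : s.length < k) (h : Similar Γ k s t) (a : A) :
    ∃ b, Similar Γ k (s ++ [a]) (t ++ [b]) := by
  obtain ⟨n, e, e', hn, rfl, rfl, hp⟩ := h
  rw [List.length_ofFn] at hs
  rw [show k - n = k - (n + 1) + 1 by omega] at hp
  obtain ⟨b, hb⟩ := hp.forth hΓ a
  exact ⟨b, n + 1, _, _, hs, ofFn_snoc _ _, ofFn_snoc _ _, hb⟩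

theorem Similar.exists_equiv [Small.{w} A] [Small.{w} B] [Finite A] [Finite B]
    {s : List A} {t : List B} (hs : s.length < k)
    (h : Similar (fun n (_ : Formula.{u₀, u, w} L n) => True) k s t) :
    ∃ σ : A ≃ B, ∀ a, Similar (fun n (_ : Formula.{u₀, u, w} L n) => True) k
      (s ++ [a]) (t ++ [σ a]) := by
  obtain ⟨n, e, e', hn, rfl, rfl, hp⟩ := h
  rw [List.length_ofFn] at hs
  rw [show k - n = k - (n + 1) + 1 by omega] at hp
  obtain ⟨σ, hσ⟩ := hp.exists_equiv
  exact ⟨σ, fun a => ⟨n + 1, _, _, hs, ofFn_snoc _ _, ofFn_snoc _ _, hσ a⟩⟩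

theorem Similar.preserves {n : ℕ} {e : Fin n → A} {e' : Fin n → B}
    (h : Similar Γ k (List.ofFn e) (List.ofFn e')) : Preserves Γ (k - n) e e' := by
  obtain ⟨n', d, d', -, h1, h2, hp⟩ := h
  obtain rfl : n' = n := by simpa using congrArg List.length h1
  rwa [List.ofFn_injective h1, List.ofFn_injective h2] at hp

theorem Similar.preserves_coext {f : E k A → B} {s : E k A}
    (h : Similar Γ k s.1 (E.coext f s).1) :
    Preserves Γ (k - s.1.length) s.1.get (fun i => f (s.initial i)) := by
  apply Similar.preserves
  rwa [List.ofFn_get]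

theorem similar_take_coext {Γ : ∀ n, Formula.{u₀, u, w} L n → Prop} {f : E k A → B}
    (nil : Similar Γ k ([] : List A) ([] : List B))
    (hf : ∀ s, Similar Γ k s.1 (E.coext f s).1) (s : E k A) (n : ℕ) :
    Similar Γ k (s.1.take n) ((E.coext f s).1.take n) := by
  rcases eq_or_ne (s.1.take n) [] with h0 | h0
  · have h1 : (E.coext f s).1.take n = [] := by
      rw [← List.length_eq_zero_iff] at h0 ⊢
      simpa [E.coext] using h0
    rw [h0, h1]
    exact nil
  · let p : E k A := ⟨s.1.take n, h0, ((List.take_prefix _ _).length_le).trans s.2.2⟩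
    have hp : (E.coext f p).1 = (E.coext f s).1.take n := by
      rw [List.prefix_iff_eq_take.1 (E.Prefix.coext (s := p) (t := s) (List.take_prefix _ _) f)]
      simp [E.coext, p]
    rw [← hp]
    exact hf p

theorem mem_S_of_similar (hΓ : IsFragment Γ) (hnot : ∀ n φ, Γ n φ → Γ n (.not φ)) {f : E k A → B}
    (h : ∀ s, Similar Γ k s.1 (E.coext f s).1) : f ∈ S L k A B := by
  intro s
  refine ⟨by simp [E.coext], ?_⟩
  obtain ⟨n, e, e', -, hs, ht, hp⟩ := h s
  simp only [← hs, ← ht]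
  exact (isPartialIso_zip_ofFn e e').2 (hp.atomicEquiv hΓ hnot)

variable [L.IsRelational]

/-- A family of pairwise comparable sequences, being non-empty as there are no nullary relations,
consists of prefixes of its longest member; so a strategy preserving atomic formulas along plays is
a homomorphism. -/
def homOfSimilar [IsEmpty (L.Relations 0)] (hΓ : IsFragment Γ) (f : E k A → B)
    (h : ∀ s, Similar Γ k s.1 (E.coext f s).1) : CoKleisliHom L k A B where
  toFun := f
  map_fun' F := isEmptyElim F
  map_rel' {m} R p hR := by
    have hm : Nonempty (Fin m) := by
      cases m with
      | zero => exact isEmptyElim R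
      | succ m => exact ⟨0⟩
    obtain ⟨i, hi⟩ := Finite.exists_max fun i => (p i).1.length
    have hpre : ∀ j, (p j).Prefix (p i) := by
      intro j
      rcases hR.1 j i with hj | hj
      · exact hj
      · rw [Subtype.ext (hj.eq_of_length (le_antisymm hj.length_le (hi j)))]
        exact List.prefix_rfl
    choose x hx hx' using fun j => (hpre j).exists_initial
    have := (h (p i)).preserves_coext.rel hΓ R x (by simpa only [hx'] using hR.2)
    simp only [hx] at this
    exact this

theorem isIMorphism_homOfSimilar [IsEmpty (L.Relations 0)] (hΓ : IsFragment Γ) (f : E k A → B)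
    (h : ∀ s, Similar Γ k s.1 (E.coext f s).1) : IsIMorphism (homOfSimilar hΓ f h) := by
  intro s t hst hc
  obtain ⟨i, hi, hi'⟩ := hst.exists_initial
  obtain ⟨j, hj, hj'⟩ := E.Prefix.exists_initial (s := t) (t := t) List.prefix_rfl
  have := (h t).preserves_coext.eq hΓ (i := i) (j := j) (by rw [hi', hj', hc])
  simp only [hi, hj] at this
  exact this

end Similar

/-! ### From strategies to equivalence -/

theorem encard_setOf_congr {A B : Type*} (σ : A ≃ B) {p : A → Prop} {q : B → Prop}
    (h : ∀ a, p a ↔ q (σ a)) : {a | p a}.encard = {b | q b}.encard := by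
  have : {b | q b} = σ '' {a | p a} := by
    ext b
    obtain ⟨a, rfl⟩ := σ.surjective b
    simpa using (h a).symm
  rw [this, σ.injective.encard_image]

/-- Positions from which all moves, up to a total of `k`, can be answered in both structures
satisfy the same formulas of the remaining quantifier rank; the formulas may contain counting
quantifiers if the answers are given by bijections. -/
theorem realize_iff_of_backAndForth {k : ℕ} (Q : ∀ n, (Fin n → A) → (Fin n → B) → Prop)
    (atomic : ∀ n e e', Q n e e' → AtomicEquiv L e e')
    (forth : ∀ n e e', n < k → Q n e e' → ∀ a, ∃ b, Q (n + 1) (Fin.snoc e a) (Fin.snoc e' b))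
    (back : ∀ n e e', n < k → Q n e e' → ∀ b, ∃ a, Q (n + 1) (Fin.snoc e a) (Fin.snoc e' b))
    {n : ℕ} (φ : Formula.{u₀, u, w} L n)
    (hφ : φ.CountingFree ∨ ∀ n e e', n < k → Q n e e' →
      ∃ σ : A ≃ B, ∀ a, Q (n + 1) (Fin.snoc e a) (Fin.snoc e' (σ a)))
    (hr : n + φ.quantifierRank ≤ k) {e : Fin n → A} {e' : Fin n → B} (hQ : Q n e e') :
    φ.Realize e ↔ φ.Realize e' := by
  have hsucc : ∀ {n : ℕ} {r : ℕ∞}, (n : ℕ∞) + (r + 1) ≤ k → n < k ∧ ((n + 1 : ℕ) : ℕ∞) + r ≤ k := by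
    intro n r h
    have h' : ((n + 1 : ℕ) : ℕ∞) + r ≤ k := by
      rw [Nat.cast_add, Nat.cast_one, add_assoc, add_comm 1 r]
      exact h
    exact ⟨by exact_mod_cast le_self_add.trans h', h'⟩
  induction φ with
  | rel R x => exact (atomic _ _ _ hQ).2 _ R x
  | eq i j => exact (atomic _ _ _ hQ).1 i j
  | not φ ih => exact not_congr (ih hφ hr hQ)
  | conj φ ih =>
    exact forall_congr' fun i => ih i (hφ.imp_left fun h => h i)
      ((add_le_add_right (le_iSup (fun i => (φ i).quantifierRank) i) _).trans hr) hQ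
  | disj φ ih =>
    exact exists_congr fun i => ih i (hφ.imp_left fun h => h i)
      ((add_le_add_right (le_iSup (fun i => (φ i).quantifierRank) i) _).trans hr) hQ
  | ex φ ih =>
    obtain ⟨hn, hr⟩ := hsucc hr
    constructor
    · rintro ⟨a, ha⟩
      obtain ⟨b, hb⟩ := forth _ _ _ hn hQ a
      exact ⟨b, (ih hφ hr hb).1 ha⟩
    · rintro ⟨b, hb⟩
      obtain ⟨a, ha⟩ := back _ _ _ hn hQ b
      exact ⟨a, (ih hφ hr ha).2 hb⟩
  | all φ ih =>
    obtain ⟨hn, hr⟩ := hsucc hr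
    constructor
    · intro h b
      obtain ⟨a, ha⟩ := back _ _ _ hn hQ b
      exact (ih hφ hr ha).1 (h a)
    · intro h a
      obtain ⟨b, hb⟩ := forth _ _ _ hn hQ a
      exact (ih hφ hr hb).2 (h b)
  | exGE N φ ih =>
    obtain ⟨hn, hr⟩ := hsucc hr
    have hφ' := hφ.resolve_left id
    obtain ⟨σ, hσ⟩ := hφ' _ _ _ hn hQ
    simp only [Formula.Realize]
    rw [encard_setOf_congr (q := fun b => φ.Realize (Fin.snoc e' b : Fin _ → B)) σ
      fun a => ih (.inr hφ') hr (hσ a)]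
  | exLE N φ ih =>
    obtain ⟨hn, hr⟩ := hsucc hr
    have hφ' := hφ.resolve_left id
    obtain ⟨σ, hσ⟩ := hφ' _ _ _ hn hQ
    simp only [Formula.Realize]
    rw [encard_setOf_congr (q := fun b => φ.Realize (Fin.snoc e' b : Fin _ → B)) σ
      fun a => ih (.inr hφ') hr (hσ a)]

section Strategies

variable {k : ℕ}

/-- Existential positive sentences are preserved by a coKleisli morphism `f`. As `f` may answer a
repeated element inconsistently, repeated elements are not played: the invariant keeps a sequence
`s` in which only new elements are recorded, and each variable is assigned a prefix of `s`. -/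
theorem realize_of_coKleisliHom [L.IsRelational] (f : CoKleisliHom L k A B) {n : ℕ}
    (φ : Formula.{u₀, u, w} L n)
    (hφ : φ.ExistentialPositive) (hr : n + φ.quantifierRank ≤ k) {e : Fin n → A} {e' : Fin n → B}
    (s : List A) (hs : s.length ≤ n) (p : Fin n → E k A) (hp : ∀ i, (p i).1 <+: s)
    (he : ∀ i, (p i).counit = e i) (he' : ∀ i, f (p i) = e' i)
    (heq : ∀ i j, e i = e j → e' i = e' j) (h : φ.Realize e) : φ.Realize e' := by
  induction φ generalizing s with
  | rel R x =>
    have := f.map_rel R (fun i => p (x i))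
      ⟨fun i j => List.prefix_or_prefix_of_prefix (hp _) (hp _), by simp only [he]; exact h⟩
    simpa only [Formula.Realize, Function.comp_def, he'] using this
  | eq i j => exact heq i j h
  | not => exact hφ.elim
  | conj φ ih =>
    exact fun i => ih i (hφ i)
      ((add_le_add_right (le_iSup (fun i => (φ i).quantifierRank) i) _).trans hr)
      s hs p hp he he' heq (h i)
  | disj φ ih =>
    obtain ⟨i, hi⟩ := h
    exact ⟨i, ih i (hφ i)
      ((add_le_add_right (le_iSup (fun i => (φ i).quantifierRank) i) _).trans hr)
      s hs p hp he he' heq hi⟩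
  | @ex n φ ih =>
    obtain ⟨a, ha⟩ := h
    have hr' : ((n + 1 : ℕ) : ℕ∞) + φ.quantifierRank ≤ k := by
      rw [Nat.cast_add, Nat.cast_one, add_assoc, add_comm 1 φ.quantifierRank]
      exact hr
    have hn : n < k := by exact_mod_cast le_self_add.trans hr'
    by_cases hex : ∃ j, e j = a
    · obtain ⟨j, rfl⟩ := hex
      refine ⟨e' j, ih hφ hr' s (by omega) (Fin.snoc p (p j)) ?_ ?_ ?_ ?_ ha⟩
      · intro i
        cases i using Fin.lastCases <;> simp [hp]
      · intro i
        cases i using Fin.lastCases <;> simp [he]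
      · intro i
        cases i using Fin.lastCases <;> simp [he']
      · intro i i'
        cases i using Fin.lastCases <;> cases i' using Fin.lastCases
        · simp
        all_goals simpa using heq _ _
    · rw [not_exists] at hex
      let t : E k A := ⟨s ++ [a], by simp, by simp; omega⟩
      refine ⟨f t, ih hφ hr' (s ++ [a]) (by simpa using hs) (Fin.snoc p t) ?_ ?_ ?_ ?_ ha⟩
      · intro i
        cases i using Fin.lastCases with
        | last => simp only [Fin.snoc_last]; exact List.prefix_rfl
        | cast i => simpa using (hp i).trans (List.prefix_append _ _)
      · intro i
        cases i using Fin.lastCases with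
        | last => simp only [Fin.snoc_last]; simp [t, E.counit]
        | cast i => simp [he]
      · intro i
        cases i using Fin.lastCases <;> simp [he']
      · intro i i'
        cases i using Fin.lastCases <;> cases i' using Fin.lastCases
        · simp
        · simpa using fun h => (hex _ h.symm).elim
        · simpa using fun h => (hex _ h).elim
        · simpa using heq _ _
  | all => exact hφ.elim
  | exGE => exact hφ.elim
  | exLE => exact hφ.elim

theorem models_of_coKleisliHom [L.IsRelational] (f : CoKleisliHom L k A B)
    {φ : Formula.{u₀, u, w} L 0} (hφ : φ ∈ existentialPositiveSentences L k) (h : Models A φ) :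
    Models B φ :=
  realize_of_coKleisliHom f φ hφ.1 (by simpa using hφ.2) [] le_rfl Fin.elim0
    (fun i => i.elim0) (fun i => i.elim0) (fun i => i.elim0) (fun i => i.elim0) h


/-- The play of `f` on the sequence `e` is `e'`. -/
def Follows (f : E k A → B) {n : ℕ} (e : Fin n → A) (e' : Fin n → B) : Prop :=
  ∃ h : (List.ofFn e).length ≤ k, E.lift f (List.ofFn e) h = List.ofFn e'

theorem follows_zero (f : E k A → B) (e : Fin 0 → A) (e' : Fin 0 → B) : Follows f e e' :=
  ⟨by simp, by simp [E.lift]⟩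

theorem Follows.unique {f : E k A → B} {n : ℕ} {e : Fin n → A} {e' e'' : Fin n → B}
    (h : Follows f e e') (h' : Follows f e e'') : e' = e'' := by
  obtain ⟨_, h⟩ := h
  obtain ⟨_, h'⟩ := h'
  exact List.ofFn_injective (h.symm.trans h')

theorem Follows.exists_snoc {f : E k A → B} {n : ℕ} {e : Fin n → A} {e' : Fin n → B}
    (h : Follows f e e') (hn : n < k) (a : A) :
    ∃ b, Follows f (Fin.snoc e a : Fin (n + 1) → A) (Fin.snoc e' b : Fin (n + 1) → B) := by
  obtain ⟨_, h⟩ := h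
  have hk : (List.ofFn e ++ [a]).length ≤ k := by simpa using hn
  refine ⟨f ⟨List.ofFn e ++ [a], by simp, hk⟩, by simpa using hn, ?_⟩
  simp only [ofFn_snoc]
  rw [E.lift_append, h]

/-- A non-empty sequence of length at most `k`, given as a tuple. -/
def E.ofTuple {n : ℕ} (e : Fin (n + 1) → A) (h : n < k) : E k A :=
  ⟨List.ofFn e, by simp, by simpa using h⟩

theorem follows_iff {f : E k A → B} {n : ℕ} {e : Fin (n + 1) → A} {e' : Fin (n + 1) → B}
    (hn : n < k) :
    Follows f e e' ↔ E.coext f (E.ofTuple e hn) = E.ofTuple e' hn := by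
  exact ⟨fun h => Subtype.ext h.2, fun h => ⟨by simpa using hn, congrArg Subtype.val h⟩⟩

theorem Follows.inverse {f : E k A → B} {g : E k B → A} {n : ℕ} {e : Fin (n + 1) → A}
    {e' : Fin (n + 1) → B} (h : Follows f e e') (hn : n < k)
    (hg : E.coext g (E.coext f (E.ofTuple e hn)) = E.ofTuple e hn) : Follows g e' e := by
  rw [follows_iff hn] at h ⊢
  rwa [h] at hg

theorem Follows.exists_prefix {f : E k A → B} {n : ℕ} {e : Fin n → A} {e' : Fin n → B}
    (h : Follows f e e') (i : Fin n) :
    ∃ p : E k A, p.1 <+: List.ofFn e ∧ p.counit = e i ∧ f p = e' i := by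
  obtain ⟨hk, h⟩ := h
  have hn : n ≤ k := by simpa using hk
  refine ⟨⟨(List.ofFn e).take (i + 1),
    List.ne_nil_of_length_pos (by rw [List.length_take, List.length_ofFn]; omega),
    (List.length_take_le' _ _).trans hk⟩, List.take_prefix _ _, ?_, ?_⟩
  · simp only [E.counit, List.getLast_eq_getElem, List.getElem_take, List.getElem_ofFn]
    congr 1
    apply Fin.ext
    simp only [List.length_take, List.length_ofFn]
    omega
  · have := List.getElem_of_eq h (i := i) (by simp)
    simpa only [E.lift, List.getElem_ofFn] using this

theorem Follows.atomicEquiv_of_mem_S [IsEmpty (L.Relations 0)] {f : E k A → B}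
    (hf : f ∈ S L k A B) {n : ℕ} {e : Fin n → A} {e' : Fin n → B} (h : Follows f e e') :
    AtomicEquiv L e e' := by
  cases n with
  | zero => exact atomicEquiv_zero e e'
  | succ n =>
    have hn : n < k := by
      obtain ⟨h, -⟩ := h
      simpa using h
    have hW := hf (E.ofTuple e hn)
    rw [(follows_iff hn).1 h] at hW
    exact (isPartialIso_zip_ofFn e e').1 hW.2

theorem Follows.rel [L.IsRelational] {f : CoKleisliHom L k A B} {n : ℕ} {e : Fin n → A}
    {e' : Fin n → B} (h : Follows f e e') {m : ℕ} (R : L.Relations m) (x : Fin m → Fin n)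
    (hR : Structure.RelMap R (fun i => e (x i))) : Structure.RelMap R (fun i => e' (x i)) := by
  choose p hp he he' using h.exists_prefix
  have := f.map_rel R (fun i => p (x i))
    ⟨fun i j => List.prefix_or_prefix_of_prefix (hp _) (hp _), by simp only [he]; exact hR⟩
  simpa only [Function.comp_def, he'] using this

theorem Follows.eq [L.IsRelational] {f : CoKleisliHom L k A B} (hf : IsIMorphism f) {n : ℕ}
    {e : Fin n → A} {e' : Fin n → B} (h : Follows f e e') {i j : Fin n} (hij : e i = e j) :
    e' i = e' j := by
  choose p hp he he' using h.exists_prefix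
  rw [← he i, ← he j] at hij
  rw [← he' i, ← he' j]
  rcases List.prefix_or_prefix_of_prefix (hp i) (hp j) with hl | hl
  · exact hf _ _ hl hij
  · exact (hf _ _ hl hij.symm).symm

end Strategies

/-! ### The three characterizations -/

section Characterizations

variable {k : ℕ}

theorem exists_coKleisliHom [L.IsRelational] [IsEmpty (L.Relations 0)] [Small.{w} B]
    (h : EquivOn (existentialPositiveSentences.{u₀, u, w} L k) A B) :
    Nonempty (CoKleisliHom L k A B) := by
  obtain ⟨f, hf⟩ := exists_strategy (k := k)
    (similar_nil (Γ := fun _ (φ : Formula.{u₀, u, w} L _) => φ.ExistentialPositive)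
      (S := existentialPositiveSentences L k)
      (fun φ hφ hr => ⟨hφ, hr⟩) h)
    fun _ _ hs hst => hst.forth isFragment_existentialPositive hs
  exact ⟨homOfSimilar isFragment_existentialPositive f hf⟩

theorem equivOn_existentialPositive_iff [L.IsRelational] [IsEmpty (L.Relations 0)]
    [Small.{w} A] [Small.{w} B] :
    EquivOn (existentialPositiveSentences.{u₀, u, w} L k) A B ↔ CoKleisliBothWays L k A B := by
  refine ⟨fun h => ⟨exists_coKleisliHom h, exists_coKleisliHom fun φ hφ => (h φ hφ).symm⟩, ?_⟩
  rintro ⟨⟨f⟩, ⟨g⟩⟩ φ hφ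
  exact ⟨models_of_coKleisliHom f hφ, models_of_coKleisliHom g hφ⟩

/-- The strategies keeping the positions equivalent form a locally invertible pair. -/
theorem backAndForth_of_equivOn [Small.{w} A] [Small.{w} B]
    (h : EquivOn (sentences.{u₀, u, w} L k) A B) : BackAndForth L k A B := by
  let Γ : ∀ n, Formula.{u₀, u, w} L n → Prop := fun _ φ => φ.CountingFree
  have hΓ : IsFragment Γ := isFragment_countingFree
  have hnot : ∀ n φ, Γ n φ → Γ n (.not φ) := fun _ _ h => h
  have nil : Similar Γ k ([] : List A) ([] : List B) :=
    similar_nil (S := sentences L k) (fun φ hφ hr => ⟨hφ, hr⟩) h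
  have forth : ∀ (s : List A) (t : List B), s.length < k → Similar Γ k s t → ∀ a, ∃ b,
    Similar Γ k (s ++ [a]) (t ++ [b]) := fun _ _ hs hst => hst.forth hΓ hs
  have back : ∀ (t : List B) (s : List A), t.length < k → Similar Γ k t s → ∀ b, ∃ a,
    Similar Γ k (t ++ [b]) (s ++ [a]) := fun _ _ hs hst => hst.forth hΓ hs
  refine ⟨{f | ∀ s : E k A, Similar Γ k s.1 (E.coext f s).1},
    {g | ∀ t : E k B, Similar Γ k t.1 (E.coext g t).1},
    exists_strategy nil forth, exists_strategy (nil.symm hnot) back,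
    fun f hf => mem_S_of_similar hΓ hnot hf, fun g hg => mem_S_of_similar hΓ hnot hg, ?_, ?_⟩
  · intro f hf s
    exact exists_strategy_through back (E.coext f s) s (by simp [E.coext])
      fun n => (similar_take_coext nil hf s n).symm hnot
  · intro g hg t
    exact exists_strategy_through forth (E.coext g t) t (by simp [E.coext])
      fun n => (similar_take_coext (nil.symm hnot) hg t n).symm hnot

theorem equivOn_of_backAndForth [IsEmpty (L.Relations 0)] (h : BackAndForth L k A B) :
    EquivOn (sentences.{u₀, u, w} L k) A B := by
  obtain ⟨F, G, ⟨f₀, hf₀⟩, ⟨g₀, hg₀⟩, hFG⟩ := h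
  intro φ hφ
  refine realize_iff_of_backAndForth (k := k)
    (fun n e e' => (∃ f ∈ F, Follows f e e') ∧ ∃ g ∈ G, Follows g e' e) ?_ ?_ ?_ φ (.inl hφ.1)
    (by simpa using hφ.2)
    ⟨⟨f₀, hf₀, follows_zero _ _ _⟩, ⟨g₀, hg₀, follows_zero _ _ _⟩⟩
  · rintro n e e' ⟨⟨f, hf, hfe⟩, -⟩
    exact hfe.atomicEquiv_of_mem_S (hFG.left_subset hf)
  · rintro n e e' hn ⟨⟨f, hf, hfe⟩, -⟩ a
    obtain ⟨b, hb⟩ := hfe.exists_snoc hn a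
    obtain ⟨g, hg, hgf⟩ := hFG.left_inv f hf (E.ofTuple _ hn)
    exact ⟨b, ⟨f, hf, hb⟩, g, hg, hb.inverse hn hgf⟩
  · rintro n e e' hn ⟨-, ⟨g, hg, hge⟩⟩ b
    obtain ⟨a, ha⟩ := hge.exists_snoc hn b
    obtain ⟨f, hf, hfg⟩ := hFG.right_inv g hg (E.ofTuple _ hn)
    exact ⟨a, ⟨f, hf, ha.inverse hn hfg⟩, g, hg, ha⟩

/-- The two strategies answer with mutually inverse bijections. -/
theorem coKleisliIso_of_equivOn [L.IsRelational] [IsEmpty (L.Relations 0)]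
    [Small.{w} A] [Small.{w} B] [Finite A] [Finite B] (hk : 0 < k)
    (h : EquivOn (countingSentences.{u₀, u, w} L k) A B) : CoKleisliIso L k A B := by
  let Γ : ∀ n, Formula.{u₀, u, w} L n → Prop := fun _ _ => True
  have hΓ : IsFragment Γ := isFragment_true
  have nil : Similar Γ k ([] : List A) ([] : List B) := similar_nil (fun φ _ hr => hr) h
  obtain ⟨σ₀, -⟩ := nil.exists_equiv hk
  have hσ : ∀ (s : List A) (t : List B), ∃ σ : A ≃ B, s.length < k → Similar Γ k s t →
      ∀ a, Similar Γ k (s ++ [a]) (t ++ [σ a]) := by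
    intro s t
    by_cases hst : s.length < k ∧ Similar Γ k s t
    · obtain ⟨σ, hσ⟩ := hst.2.exists_equiv hst.1
      exact ⟨σ, fun _ _ => hσ⟩
    · exact ⟨σ₀, fun h1 h2 => (hst ⟨h1, h2⟩).elim⟩
  choose σ hσ using hσ
  have key : ∀ s : List A, s.length ≤ k → Similar Γ k s (run (fun s t => σ s t) s) := by
    intro s
    induction s using List.reverseRecOn with
    | nil => exact fun _ => nil
    | append_singleton s a ih =>
      intro hs
      rw [List.length_append, List.length_singleton] at hs
      rw [run_append]
      exact hσ _ _ (by omega) (ih (by omega)) _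
  have hτσ : ∀ s, run (fun t s => (σ s t).symm) (run (fun s t => σ s t) s) = s :=
    run_run fun s t a => (σ s t).symm_apply_apply a
  have hστ : ∀ t, run (fun s t => σ s t) (run (fun t s => (σ s t).symm) t) = t :=
    run_run fun t s b => (σ s t).apply_symm_apply b
  have hf : ∀ s : E k A, Similar Γ k s.1 (E.coext (strategy k fun s t => σ s t) s).1 := by
    intro s
    rw [coext_strategy]
    exact key _ s.2.2
  have hg : ∀ t : E k B, Similar Γ k t.1 (E.coext (strategy k fun t s => (σ s t).symm) t).1 := by
    intro t
    rw [coext_strategy]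
    have := key (run (fun t s => (σ s t).symm) t.1) (by simpa using t.2.2)
    rw [hστ] at this
    exact this.symm fun _ _ _ => trivial
  refine ⟨homOfSimilar hΓ _ hf, homOfSimilar hΓ _ hg, isIMorphism_homOfSimilar hΓ _ hf,
    isIMorphism_homOfSimilar hΓ _ hg, fun s => Subtype.ext ?_, fun t => Subtype.ext ?_⟩
  · change (E.coext (strategy k fun t s => (σ s t).symm)
      (E.coext (strategy k fun s t => σ s t) s)).1 = s.1
    rw [coext_strategy, coext_strategy, hτσ]
  · change (E.coext (strategy k fun s t => σ s t)
      (E.coext (strategy k fun t s => (σ s t).symm) t)).1 = t.1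
    rw [coext_strategy, coext_strategy, hστ]

theorem equivOn_of_coKleisliIso [L.IsRelational] (h : CoKleisliIso L k A B) :
    EquivOn (countingSentences.{u₀, u, w} L k) A B := by
  obtain ⟨f, g, hf, hg, hgf, hfg⟩ := h
  let Q (n : ℕ) (e : Fin n → A) (e' : Fin n → B) : Prop := Follows f e e' ∧ Follows g e' e
  have forth : ∀ n (e : Fin n → A) (e' : Fin n → B), n < k → Q n e e' →
      ∀ a, ∃ b, Q (n + 1) (Fin.snoc e a) (Fin.snoc e' b) := by
    rintro n e e' hn ⟨hfe, -⟩ a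
    obtain ⟨b, hb⟩ := hfe.exists_snoc hn a
    exact ⟨b, hb, hb.inverse hn (hgf _)⟩
  have back : ∀ n (e : Fin n → A) (e' : Fin n → B), n < k → Q n e e' →
      ∀ b, ∃ a, Q (n + 1) (Fin.snoc e a) (Fin.snoc e' b) := by
    rintro n e e' hn ⟨-, hge⟩ b
    obtain ⟨a, ha⟩ := hge.exists_snoc hn b
    exact ⟨a, ha.inverse hn (hfg _), ha⟩
  intro φ hφ
  refine realize_iff_of_backAndForth (k := k) Q ?_ forth back φ (.inr ?_)
    (by simpa using show φ.quantifierRank ≤ k from hφ)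
    ⟨follows_zero _ _ _, follows_zero _ _ _⟩
  · rintro n e e' ⟨hfe, hge⟩
    exact ⟨fun _ _ => ⟨hfe.eq hf, hge.eq hg⟩, fun _ R x => ⟨hfe.rel R x, hge.rel R x⟩⟩
  · intro n e e' hn hQ
    choose σ hσ using forth n e e' hn hQ
    refine ⟨Equiv.ofBijective σ ⟨fun a a' haa' => ?_, fun b => ?_⟩, hσ⟩
    · have := (hσ a).2.unique (haa' ▸ (hσ a').2)
      simpa using congrFun this (Fin.last n)
    · obtain ⟨a, ha⟩ := back n e e' hn hQ b
      refine ⟨a, ?_⟩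
      simpa using congrFun ((hσ a).1.unique ha.1) (Fin.last n)

end Characterizations

end EFComonad

theorem mainTheorem1 (L : FirstOrder.Language.{u₀, u}) [L.IsRelational]
    [IsEmpty (L.Relations 0)] (k : ℕ) (hk : 0 < k) :
    (∀ (A B : Type v) [L.Structure A] [L.Structure B],
      EFComonad.EquivOn
          (EFComonad.existentialPositiveSentences.{u₀, u, max u v w} L k) A B ↔
        EFComonad.CoKleisliBothWays L k A B) ∧
    (∀ (A B : Type v) [L.Structure A] [L.Structure B],
      EFComonad.EquivOn (EFComonad.sentences.{u₀, u, max u v w} L k) A B ↔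
        EFComonad.BackAndForth L k A B) ∧
    (∀ (A B : Type v) [L.Structure A] [L.Structure B] [Finite A] [Finite B],
      EFComonad.EquivOn (EFComonad.countingSentences.{u₀, u, max u v w} L k) A B ↔
        EFComonad.CoKleisliIso L k A B) := by
  have hsmall (C : Type v) : Small.{max u v w} C := small_max.{max u w} C
  refine ⟨fun A B _ _ => ?_, fun A B _ _ => ?_, fun A B _ _ _ _ => ?_⟩
  · exact EFComonad.equivOn_existentialPositive_iff
  · exact ⟨EFComonad.backAndForth_of_equivOn, EFComonad.equivOn_of_backAndForth⟩
  · exact ⟨EFComonad.coKleisliIso_of_equivOn hk, EFComonad.equivOn_of_coKleisliIso⟩
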